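/- Let $F\in\mathbb C[x_1,\dots,x_s]$, let $X=\mathbf V(F)\subset\mathbb C^s$, let $p\in X$ be a non-singular point and let $n\in\mathbb N$. Here non-singular means that the local ring $R_p$ defined next is regular. Let $(R_p,\mathfrak m_p)$ be the localization of $R=\mathbb C[x_1,\dots,x_s]/\langle F\rangle$ at the maximal ideal of $p$, and let $(A_p,\mathfrak n_p)$ be the localization of $\mathbb C[x_1,\dots,x_s]$ at the maximal ideal of $p$. Put $$T^n_pX=(\mathfrak m_p/\mathfrak m_p^{n+1})^\vee,\qquad T^n_p\mathbb C^s=(\mathfrak n_p/\mathfrak n_p^{n+1})^\vee$$ (dual complex vector spaces). Let $N=\binom{n+s}{s}$, and index the coordinates of $\mathbb C^{N-1}$ by the multi-indices $\alpha\in\mathbb N^s$ with $1\le|\alpha|\le n$. Let $\mathrm{Jac}_n(F)$ be the matrix with rows indexed by the $\beta\in\mathbb N^s$ with $0\le|\beta|\le n-1$ (no rows if $n=0$), columns indexed by the $\alpha\in\mathbb N^s$ with $1\le|\alpha|\le n$, and $(\beta,\alpha)$ entry $$\frac{\beta!}{\alpha!}\binom{\alpha}{\beta}\,\partial^{\alpha-\beta}F,$$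 where $\partial^{\alpha-\beta}F:=0$ unless $\beta_i\le\alpha_i$ for all $i$; let $\mathrm{Jac}_n(F)|_p$ be its value at $p$. The map $T^n_p\mathbb C^s\to\mathbb C^{N-1}$, $\psi\mapsto\big(\psi([(x-p)^\alpha])\big)_{1\le|\alpha|\le n}$, is an isomorphism. If $\psi$ corresponds to $(t_\alpha)$, then $\psi([f])=\sum_{\alpha}t_\alpha\,\frac{\partial^\alpha f(p)}{\alpha!}$ for every polynomial $f$ with $f(p)=0$. The map $T^n_pX\to T^n_p\mathbb C^s$ dual to the restriction $\mathfrak n_p/\mathfrak n_p^{n+1}\to\mathfrak m_p/\mathfrak m_p^{n+1}$ is injective. Regarding $T^n_pX$ in this way as a subspace of $\mathbb C^{N-1}$, one has $$T^n_pX=\ker\big(\mathrm{Jac}_n(F)|_p\big).$$ -/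

import Mathlib

noncomputable section

namespace HigherTangent

/-! ### Higher-order tangent spaces of local `ℂ`-algebras -/

/-- The maximal ideal `𝔪` of a local `ℂ`-algebra, as a complex vector space. -/
abbrev maxIdeal (A : Type*) [CommRing A] [Algebra ℂ A] [IsLocalRing A] : Submodule ℂ A :=
  (IsLocalRing.maximalIdeal A).restrictScalars ℂ

/-- The power `𝔪 ^ k` of the maximal ideal (product of ideals), as a complex vector space. -/
abbrev maxIdealPow (A : Type*) [CommRing A] [Algebra ℂ A] [IsLocalRing A] (k : ℕ) :
    Submodule ℂ A :=
  (IsLocalRing.maximalIdeal A ^ k).restrictScalars ℂ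

/-- The complex vector space `𝔪 / 𝔪 ^ (n + 1)`. -/
abbrev Cotangent (A : Type*) [CommRing A] [Algebra ℂ A] [IsLocalRing A] (n : ℕ) : Type _ :=
  maxIdeal A ⧸ (maxIdealPow A (n + 1)).submoduleOf (maxIdeal A)

/-- The higher-order tangent space `(𝔪 / 𝔪 ^ (n + 1))^∨`. -/
abbrev Tangent (A : Type*) [CommRing A] [Algebra ℂ A] [IsLocalRing A] (n : ℕ) : Type _ :=
  Module.Dual ℂ (Cotangent A n)

section Functoriality

variable {A B : Type*} [CommRing A] [Algebra ℂ A] [IsLocalRing A]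
  [CommRing B] [Algebra ℂ B] [IsLocalRing B]

theorem maxIdeal_le_comap (f : A →ₐ[ℂ] B) [IsLocalHom f] :
    ∀ a ∈ maxIdeal A, f.toLinearMap a ∈ maxIdeal B := by
  intro a ha
  have h : a ∈ nonunits A := ha
  exact (map_mem_nonunits_iff f a).2 h

/-- The map `𝔪_A → 𝔪_B` induced by a local homomorphism `A → B`. -/
def maxIdealMap (f : A →ₐ[ℂ] B) [IsLocalHom f] : maxIdeal A →ₗ[ℂ] maxIdeal B :=
  f.toLinearMap.restrict (maxIdeal_le_comap f)

theorem maxIdealPow_le_comap (f : A →ₐ[ℂ] B) [IsLocalHom f] (k : ℕ) :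
    (maxIdealPow A k).submoduleOf (maxIdeal A) ≤
      ((maxIdealPow B k).submoduleOf (maxIdeal B)).comap (maxIdealMap f) := by
  intro a ha
  have h1 : (a : A) ∈ IsLocalRing.maximalIdeal A ^ k := ha
  have h2 : (IsLocalRing.maximalIdeal A).map f ≤ IsLocalRing.maximalIdeal B :=
    Ideal.map_le_iff_le_comap.2 (maxIdeal_le_comap f)
  have h3 : f (a : A) ∈ (IsLocalRing.maximalIdeal A ^ k).map f := Ideal.mem_map_of_mem f h1
  rw [Ideal.map_pow] at h3
  exact Ideal.pow_right_mono h2 k h3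

/-- The map `𝔪_A / 𝔪_A ^ (n + 1) → 𝔪_B / 𝔪_B ^ (n + 1)` induced by a local homomorphism. -/
def cotangentMap (f : A →ₐ[ℂ] B) [IsLocalHom f] (n : ℕ) : Cotangent A n →ₗ[ℂ] Cotangent B n :=
  Submodule.mapQ _ _ (maxIdealMap f) (maxIdealPow_le_comap f (n + 1))

/-- The transpose of `cotangentMap`. -/
def tangentMap (f : A →ₐ[ℂ] B) [IsLocalHom f] (n : ℕ) : Tangent B n →ₗ[ℂ] Tangent A n :=
  (cotangentMap f n).dualMap

end Functoriality

/-! ### Local rings at points -/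

section Points

variable {R : Type*} [CommRing R] [Algebra ℂ R]

instance (x : R →ₐ[ℂ] ℂ) : (RingHom.ker x).IsPrime := RingHom.ker_isPrime x.toRingHom

/-- The local ring `R_p` of a `ℂ`-algebra `R` at a point, the latter being given as the
evaluation homomorphism `x : R → ℂ` at the point: the localization at the maximal ideal
`ker x` of the functions that vanish there. -/
abbrev LocalRing (x : R →ₐ[ℂ] ℂ) : Type _ := Localization.AtPrime (RingHom.ker x)

/-- The ideal of functions vanishing at the point, as a complex vector space. -/
abbrev vanishing (x : R →ₐ[ℂ] ℂ) : Submodule ℂ R := (RingHom.ker x).restrictScalars ℂ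

theorem germ_mem (x : R →ₐ[ℂ] ℂ) :
    ∀ f ∈ vanishing x, (Algebra.algHom ℂ R (LocalRing x)).toLinearMap f ∈
      maxIdeal (LocalRing x) := by
  intro f hf
  exact (IsLocalization.AtPrime.to_map_mem_maximal_iff (LocalRing x) (RingHom.ker x) f).2 hf

/-- The class of `f / 1` in `𝔪_p / 𝔪_p ^ (n + 1)`, for a function `f` vanishing at the point. -/
def jet (x : R →ₐ[ℂ] ℂ) (n : ℕ) : vanishing x →ₗ[ℂ] Cotangent (LocalRing x) n :=
  (Submodule.mkQ _).comp ((Algebra.algHom ℂ R (LocalRing x)).toLinearMap.restrict (germ_mem x))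

end Points

/-! ### Affine space and a hypersurface in it -/

section Hypersurface

open MvPolynomial

variable {s : ℕ}

/-- The point `p` of affine space `ℂ^s`, as evaluation of polynomials at `p`. -/
def affinePoint (p : Fin s → ℂ) : MvPolynomial (Fin s) ℂ →ₐ[ℂ] ℂ := aeval p

/-- The ring `ℂ[x_1, …, x_s] / ⟨F⟩`. -/
abbrev CoordRing (F : MvPolynomial (Fin s) ℂ) : Type :=
  MvPolynomial (Fin s) ℂ ⧸ Ideal.span {F}

/-- The point `p` of `V(F)`, as evaluation at `p` on `ℂ[x_1, …, x_s] / ⟨F⟩`. -/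
def hypersurfacePoint (F : MvPolynomial (Fin s) ℂ) (p : Fin s → ℂ) (hp : eval p F = 0) :
    CoordRing F →ₐ[ℂ] ℂ :=
  Ideal.Quotient.liftₐ (Ideal.span {F}) (affinePoint p) (by
    intro a ha
    obtain ⟨g, rfl⟩ := Ideal.mem_span_singleton.1 ha
    simp [affinePoint, aeval_eq_eval, hp])

theorem ker_affinePoint (F : MvPolynomial (Fin s) ℂ) (p : Fin s → ℂ) (hp : eval p F = 0) :
    RingHom.ker (affinePoint p) =
      (RingHom.ker (hypersurfacePoint F p hp)).comap
        (Ideal.Quotient.mkₐ ℂ (Ideal.span {F})).toRingHom :=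
  rfl

/-- Restriction of germs of functions at `p` from `ℂ^s` to `V(F)`. -/
def restrictGerm (F : MvPolynomial (Fin s) ℂ) (p : Fin s → ℂ) (hp : eval p F = 0) :
    LocalRing (affinePoint p) →ₐ[ℂ] LocalRing (hypersurfacePoint F p hp) :=
  Localization.localAlgHom _ _ (Ideal.Quotient.mkₐ ℂ (Ideal.span {F})) (ker_affinePoint F p hp)

instance (F : MvPolynomial (Fin s) ℂ) (p : Fin s → ℂ) (hp : eval p F = 0) :
    IsLocalHom (restrictGerm F p hp) :=
  ⟨(Localization.isLocalHom_localRingHom _ _ _ (ker_affinePoint F p hp)).map_nonunit⟩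

/-- The natural map `T^n_p X → T^n_p ℂ^s` for `X = V(F)`. -/
def tangentInclusion (F : MvPolynomial (Fin s) ℂ) (p : Fin s → ℂ) (hp : eval p F = 0) (n : ℕ) :
    Tangent (LocalRing (hypersurfacePoint F p hp)) n →ₗ[ℂ] Tangent (LocalRing (affinePoint p)) n :=
  tangentMap (restrictGerm F p hp) n

/-! ### Multi-indices and the higher-order Jacobian matrix -/

/-- Multi-indices `α` with `1 ≤ |α| ≤ n`. -/
abbrev ColIdx (s n : ℕ) : Type := {α : Fin s →₀ ℕ // 1 ≤ α.degree ∧ α.degree ≤ n}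

/-- Multi-indices `β` with `0 ≤ |β| ≤ n - 1`. -/
abbrev RowIdx (s n : ℕ) : Type := {β : Fin s →₀ ℕ // β.degree < n}

instance (s n : ℕ) : Fintype (ColIdx s n) :=
  ((Finsupp.finite_of_degree_le (σ := Fin s) n).subset fun _ h => h.2).fintype

/-- The iterated partial derivative `∂^α = ∂_1^{α_1} ⋯ ∂_s^{α_s}`. -/
def partialD (α : Fin s →₀ ℕ) : Module.End ℂ (MvPolynomial (Fin s) ℂ) :=
  ((List.finRange s).map fun i => (pderiv i).toLinearMap ^ α i).prod

/-- `α! = α_1! ⋯ α_s!`. -/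
def multiFactorial (α : Fin s →₀ ℕ) : ℕ := ∏ i, (α i).factorial

/-- `binom(α, β) = ∏ i, binom(α_i, β_i)`. -/
def multiChoose (α β : Fin s →₀ ℕ) : ℕ := ∏ i, (α i).choose (β i)

open Classical in
/-- The Jacobian matrix of order `n` of `F`, with `(β, α)` entry
`β! binom(α, β) ∂^(α - β) F / α!`, where `∂^(α - β) F = 0` unless `β ≤ α`. -/
def jacobian (n : ℕ) (F : MvPolynomial (Fin s) ℂ) :
    Matrix (RowIdx s n) (ColIdx s n) (MvPolynomial (Fin s) ℂ) :=
  Matrix.of fun β α =>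
    C ((multiFactorial β.1 * multiChoose α.1 β.1 : ℂ) / multiFactorial α.1) *
      if β.1 ≤ α.1 then partialD (α.1 - β.1) F else 0

/-- `Jac_n(F)|_p`. -/
def jacobianAt (n : ℕ) (F : MvPolynomial (Fin s) ℂ) (p : Fin s → ℂ) :
    Matrix (RowIdx s n) (ColIdx s n) ℂ :=
  (jacobian n F).map (eval p)

/-! ### Coordinates on `T^n_p ℂ^s` -/

/-- `(x - p)^α`. -/
def shiftedMonomial (p : Fin s → ℂ) (α : Fin s →₀ ℕ) : MvPolynomial (Fin s) ℂ :=
  ∏ i, (X i - C (p i)) ^ α i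

theorem shiftedMonomial_mem {n : ℕ} (p : Fin s → ℂ) (α : ColIdx s n) :
    shiftedMonomial p α.1 ∈ vanishing (affinePoint p) := by
  have h : ∃ i, α.1 i ≠ 0 := by
    by_contra! h
    have h0 : α.1 = 0 := Finsupp.ext h
    have := α.2.1
    simp [h0] at this
  obtain ⟨i, hi⟩ := h
  change affinePoint p (shiftedMonomial p α.1) = 0
  rw [shiftedMonomial, map_prod]
  exact Finset.prod_eq_zero (Finset.mem_univ i) (by simp [affinePoint, hi])

/-- The coordinate map `T^n_p ℂ^s → ℂ^(N-1)`, `N - 1` being the number of multi-indices `α` with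
`1 ≤ |α| ≤ n`: the `α`-coordinate of a functional is its value on the class of `(x - p)^α`. -/
def coords (p : Fin s → ℂ) (n : ℕ) :
    Tangent (LocalRing (affinePoint p)) n →ₗ[ℂ] (ColIdx s n → ℂ) :=
  LinearMap.pi fun α =>
    LinearMap.applyₗ (jet (affinePoint p) n ⟨shiftedMonomial p α.1, shiftedMonomial_mem p α⟩)

end Hypersurface

end HigherTangent

end

/-!
Two facts reduce the theorem to linear algebra on polynomials.

* For a point `x : R → ℂ` of a `ℂ`-algebra `R` with maximal ideal `M = ker x`, the map
  `jet x n : M → 𝔪 / 𝔪 ^ (n + 1)` into the cotangent space of the localization is surjective with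
  kernel `M ^ (n + 1)`, because localizing at a maximal ideal does not change the quotients by its
  powers (`jet_surjective`, `jet_eq_zero_iff`). A functional on `𝔪 / 𝔪 ^ (n + 1)` is thus a
  functional on `M` that vanishes on `M ^ (n + 1)`.
* On `ℂ[x_1, …, x_s]`, the substitution `translate p : x ↦ x + p` carries `M ^ k` to the polynomials
  without terms of degree `< k` and `(x - p)^α` to `x^α`, and the coefficients of `translate p f`
  are the Taylor coefficients `∂^α f (p) / α!` (`eval_partialD_div_multiFactorial`).

Hence a functional on `M / M ^ (n + 1)` has the form `f ↦ ∑ α, t α * (∂^α f (p) / α!)` for a unique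
vector `t`, which gives the coordinates. The surjection from `ℂ[x_1, …, x_s]` to the coordinate ring
of `V(F)` induces a surjection of cotangent spaces whose kernel consists of the jets of the
multiples of `F`, so `t` is tangent to `V(F)` exactly when its functional kills all `F * h`. By
linearity it suffices to take `h = (x - p)^β`. For `|β| < n` the value at `F * (x - p)^β` is the
`β`-entry of `Jac_n(F)|_p · t`, since `β! * binom(α, β) / α! = 1 / (α - β)!`; for `|β| ≥ n` it
vanishes, since `F(p) = 0` (`taylorFunctional_mul_shiftedMonomial`,
`taylorFunctional_mul_eq_zero_iff`).
-/

open MvPolynomial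

noncomputable section

namespace HigherTangent

/-! ### Jets of functions at a point of a `ℂ`-algebra -/

section Jets

variable {R : Type*} [CommRing R] [Algebra ℂ R]

theorem ker_isMaximal (x : R →ₐ[ℂ] ℂ) : (RingHom.ker x).IsMaximal :=
  RingHom.ker_isMaximal_of_surjective x fun c => ⟨algebraMap ℂ R c, by simp⟩

theorem jet_eq_zero_iff (x : R →ₐ[ℂ] ℂ) (n : ℕ) (f : vanishing x) :
    jet x n f = 0 ↔ (f : R) ∈ RingHom.ker x ^ (n + 1) := by
  have := ker_isMaximal x
  rw [← IsLocalization.AtPrime.under_maximalIdeal_pow (RingHom.ker x) (LocalRing x) (n + 1)]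
  exact Submodule.Quotient.mk_eq_zero _

theorem jet_surjective (x : R →ₐ[ℂ] ℂ) (n : ℕ) : Function.Surjective (jet x n) := by
  have := ker_isMaximal x
  intro c
  obtain ⟨⟨a, ha⟩, rfl⟩ := Submodule.Quotient.mk_surjective _ c
  obtain ⟨r, hr⟩ := (IsLocalization.AtPrime.equivQuotMaximalIdealPow (RingHom.ker x)
    (LocalRing x) (n + 1)).surjective (Ideal.Quotient.mk _ a)
  obtain ⟨r, rfl⟩ := Ideal.Quotient.mk_surjective r
  rw [IsLocalization.AtPrime.equivQuotMaximalIdealPow_apply_mk, Ideal.Quotient.eq] at hr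
  have hr' : algebraMap R (LocalRing x) r ∈ IsLocalRing.maximalIdeal (LocalRing x) := by
    have h := Ideal.add_mem _ (Ideal.pow_le_self n.succ_ne_zero hr) ha
    rwa [sub_add_cancel] at h
  refine ⟨⟨r, (IsLocalization.AtPrime.to_map_mem_maximal_iff (LocalRing x)
    (RingHom.ker x) r).1 hr'⟩, ?_⟩
  exact (Submodule.Quotient.eq _).2 hr

/-- Functionals on `𝔪 / 𝔪 ^ (n + 1)` are the functionals on the vanishing ideal that kill its
`(n + 1)`-st power. -/
theorem exists_tangent_apply_jet (x : R →ₐ[ℂ] ℂ) (n : ℕ) (φ : Module.Dual ℂ (vanishing x))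
    (hφ : ∀ f : vanishing x, (f : R) ∈ RingHom.ker x ^ (n + 1) → φ f = 0) :
    ∃ ψ : Tangent (LocalRing x) n, ∀ f, ψ (jet x n f) = φ f := by
  have h : φ ∈ LinearMap.range (jet x n).dualMap := by
    rw [LinearMap.range_dualMap_eq_dualAnnihilator_ker, Submodule.mem_dualAnnihilator]
    exact fun f hf => hφ f ((jet_eq_zero_iff x n f).1 hf)
  obtain ⟨ψ, rfl⟩ := h
  exact ⟨ψ, fun _ => rfl⟩

end Jets

/-! ### Taylor expansion of polynomials at a point -/

section Taylor

variable {s : ℕ}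

/-- The automorphism `f ↦ f(x + p)` of the polynomial ring, so that the coefficients of
`translate p f` are the Taylor coefficients of `f` at `p`. -/
def translate (p : Fin s → ℂ) : MvPolynomial (Fin s) ℂ ≃ₐ[ℂ] MvPolynomial (Fin s) ℂ :=
  AlgEquiv.ofAlgHom (aeval fun i => X i + C (p i)) (aeval fun i => X i - C (p i))
    (by ext i; simp [algHom_C]) (by ext i; simp [algHom_C])

@[simp]
theorem translate_X (p : Fin s → ℂ) (i : Fin s) : translate p (X i) = X i + C (p i) := by
  simp [translate]

@[simp]
theorem translate_C (p : Fin s → ℂ) (c : ℂ) : translate p (C c) = C c := by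
  simp [translate]

theorem translate_shiftedMonomial (p : Fin s → ℂ) (α : Fin s →₀ ℕ) :
    translate p (shiftedMonomial p α) = monomial α 1 := by
  simp [shiftedMonomial, monomial_eq, Finsupp.prod_fintype]

theorem constantCoeff_translate (p : Fin s → ℂ) (f : MvPolynomial (Fin s) ℂ) :
    coeff 0 (translate p f) = eval p f := by
  have h : ((aeval (0 : Fin s → ℂ)).comp (translate p).toAlgHom) = aeval p := by
    ext i; simp
  have := DFunLike.congr_fun h f
  simpa [aeval_eq_eval, ← constantCoeff_eq] using this

theorem translate_pderiv (p : Fin s → ℂ) (i : Fin s) (f : MvPolynomial (Fin s) ℂ) :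
    translate p (pderiv i f) = pderiv i (translate p f) := by
  induction f using MvPolynomial.induction_on with
  | C a => simp
  | add f g hf hg => simp [hf, hg]
  | mul_X f j hf => by_cases h : j = i <;> simp [hf, pderiv_X, h]

theorem translate_pderiv_pow (p : Fin s → ℂ) (i : Fin s) (k : ℕ) (f : MvPolynomial (Fin s) ℂ) :
    translate p (((pderiv i).toLinearMap ^ k) f) = ((pderiv i).toLinearMap ^ k) (translate p f) := by
  induction k with
  | zero => simp
  | succ k ih => simp only [pow_succ', Module.End.mul_apply, ← ih]; exact translate_pderiv p i _

theorem translate_partialD (p : Fin s → ℂ) (α : Fin s →₀ ℕ) (f : MvPolynomial (Fin s) ℂ) :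
    translate p (partialD α f) = partialD α (translate p f) := by
  unfold partialD
  induction List.finRange s with
  | nil => simp
  | cons i l ih => simp [translate_pderiv_pow, ih]

theorem coeff_pderiv_pow (i : Fin s) (k : ℕ) (γ : Fin s →₀ ℕ) (f : MvPolynomial (Fin s) ℂ) :
    coeff γ (((pderiv i).toLinearMap ^ k) f) =
      (γ i + 1).ascFactorial k * coeff (γ + Finsupp.single i k) f := by
  induction k generalizing γ with
  | zero => simp
  | succ k ih =>
    rw [pow_succ', Module.End.mul_apply]
    change coeff γ (pderiv i _) = _
    rw [coeff_pderiv, ih, add_assoc, ← Finsupp.single_add, add_comm 1 k, Finsupp.add_apply,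
      Finsupp.single_eq_same, ← Nat.succ_eq_add_one (γ i + 1)]
    have h := Nat.succ_ascFactorial (γ i + 1) k
    rw [← Nat.ascFactorial_succ] at h
    rw [← h]
    push_cast
    ring

/-- The factor contributed by `∂_i^{α_i}` to a coefficient is `α_i!` where the exponent of `x_i` is
zero; the entries of `l` are distinct, so no derivative shifts the exponent seen by another. -/
theorem coeff_list_prod_pderiv_pow (α : Fin s →₀ ℕ) (l : List (Fin s)) (hl : l.Nodup)
    (γ : Fin s →₀ ℕ) (hγ : ∀ i ∈ l, γ i = 0) (f : MvPolynomial (Fin s) ℂ) :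
    coeff γ ((l.map fun i => (pderiv i).toLinearMap ^ α i).prod f) =
      (l.map fun i => ((α i).factorial : ℂ)).prod *
        coeff (γ + (l.map fun i => Finsupp.single i (α i)).sum) f := by
  induction l generalizing γ with
  | nil => simp
  | cons i l ih =>
    obtain ⟨hil, hl⟩ := List.nodup_cons.1 hl
    rw [List.map_cons, List.prod_cons, Module.End.mul_apply, coeff_pderiv_pow, ih hl,
      hγ i List.mem_cons_self, zero_add, Nat.one_ascFactorial]
    · simp [add_assoc, mul_assoc]
    · intro j hj
      have hij : i ≠ j := fun h => hil (h ▸ hj)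
      simp [hγ j (List.mem_cons_of_mem _ hj), hij]

theorem coeff_zero_partialD (α : Fin s →₀ ℕ) (f : MvPolynomial (Fin s) ℂ) :
    coeff 0 (partialD α f) = multiFactorial α * coeff α f := by
  rw [partialD, coeff_list_prod_pderiv_pow α _ (List.nodup_finRange s) 0 (by simp), zero_add]
  congr 2
  · simp [multiFactorial, Fin.prod_univ_def, Function.comp_def]
  · rw [← Fin.sum_univ_def, Finsupp.univ_sum_single]

theorem multiFactorial_ne_zero (α : Fin s →₀ ℕ) : (multiFactorial α : ℂ) ≠ 0 := by
  simp [multiFactorial, Finset.prod_eq_zero_iff, Nat.factorial_ne_zero]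

/-- The Taylor coefficient `∂^α f (p) / α!` is a coefficient of `f(x + p)`. -/
theorem eval_partialD_div_multiFactorial (p : Fin s → ℂ) (α : Fin s →₀ ℕ)
    (f : MvPolynomial (Fin s) ℂ) :
    eval p (partialD α f) / multiFactorial α = coeff α (translate p f) := by
  rw [← constantCoeff_translate, translate_partialD, coeff_zero_partialD,
    mul_div_cancel_left₀ _ (multiFactorial_ne_zero α)]

theorem mem_ker_affinePoint (p : Fin s → ℂ) (f : MvPolynomial (Fin s) ℂ) :
    f ∈ RingHom.ker (affinePoint p) ↔ eval p f = 0 := by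
  rw [RingHom.mem_ker, affinePoint, aeval_eq_eval]

theorem ker_affinePoint_eq_comap (p : Fin s → ℂ) :
    RingHom.ker (affinePoint p) =
      (idealOfVars (Fin s) ℂ).comap (translate p).toRingEquiv := by
  ext f
  rw [mem_ker_affinePoint, Ideal.mem_comap, ← pow_one (idealOfVars (Fin s) ℂ),
    mem_pow_idealOfVars_iff', ← constantCoeff_translate]
  simp [Finsupp.degree_eq_zero_iff]

theorem mem_ker_affinePoint_pow (p : Fin s → ℂ) (k : ℕ) (f : MvPolynomial (Fin s) ℂ) :
    f ∈ RingHom.ker (affinePoint p) ^ k ↔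
      ∀ α : Fin s →₀ ℕ, α.degree < k → coeff α (translate p f) = 0 := by
  rw [ker_affinePoint_eq_comap, ← Ideal.map_symm, ← Ideal.map_pow, Ideal.map_symm,
    Ideal.mem_comap, mem_pow_idealOfVars_iff']
  rfl

end Taylor

/-! ### Functionals given by Taylor coefficients -/

section Functionals

variable {s n : ℕ}

/-- The functional `f ↦ ∑ α, t α * (∂^α f (p) / α!)` on all polynomials, the Taylor coefficients
being written as coefficients of `f(x + p)`. -/
def taylorFunctional (p : Fin s → ℂ) (t : ColIdx s n → ℂ) : Module.Dual ℂ (MvPolynomial (Fin s) ℂ) :=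
  ∑ α, t α • (lcoeff ℂ α.1 ∘ₗ (translate p).toLinearMap)

theorem taylorFunctional_apply (p : Fin s → ℂ) (t : ColIdx s n → ℂ) (f : MvPolynomial (Fin s) ℂ) :
    taylorFunctional p t f = ∑ α, t α * coeff α.1 (translate p f) := by
  simp [taylorFunctional]

theorem taylorFunctional_shiftedMonomial (p : Fin s → ℂ) (t : ColIdx s n → ℂ) (α : ColIdx s n) :
    taylorFunctional p t (shiftedMonomial p α.1) = t α := by
  classical
  simp [taylorFunctional_apply, translate_shiftedMonomial, coeff_monomial, Subtype.coe_inj]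

/-- Taylor expansion at `p`, truncated after degree `n`; the constant term `f(p)` is zero. -/
theorem jet_eq_sum (p : Fin s → ℂ) (f : vanishing (affinePoint p)) :
    jet (affinePoint p) n f = ∑ α : ColIdx s n, coeff α.1 (translate p f.1) •
      jet (affinePoint p) n ⟨shiftedMonomial p α.1, shiftedMonomial_mem p α⟩ := by
  classical
  simp_rw [← map_smul, ← map_sum]
  rw [← sub_eq_zero, ← map_sub, jet_eq_zero_iff, mem_ker_affinePoint_pow]
  intro γ hγ
  have h0 : coeff 0 (translate p f.1) = 0 := by
    rw [constantCoeff_translate]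
    exact (mem_ker_affinePoint p f.1).1 f.2
  simp only [AddSubgroupClass.coe_sub, AddSubmonoidClass.coe_finsetSum, Submodule.coe_smul,
    map_sub, map_sum, map_smul, translate_shiftedMonomial, coeff_sub, coeff_sum, coeff_smul,
    coeff_monomial, smul_eq_mul, mul_ite, mul_one, mul_zero]
  rw [sub_eq_zero]
  by_cases hγ0 : γ = 0
  · subst hγ0
    rw [h0, Finset.sum_eq_zero]
    intro α _
    have : α.1 ≠ 0 := fun h => by simpa [h] using α.2.1
    simp [this]
  · have h1 : 1 ≤ γ.degree :=
      Nat.one_le_iff_ne_zero.2 fun h => hγ0 ((Finsupp.degree_eq_zero_iff γ).1 h)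
    rw [Finset.sum_eq_single (⟨γ, h1, Nat.lt_succ_iff.1 hγ⟩ : ColIdx s n)]
    · simp
    · intro α _ hα
      rw [if_neg fun h => hα (Subtype.ext h)]
    · simp

/-- Every functional on `𝔪 / 𝔪 ^ (n + 1)` is the Taylor functional of its coordinates. -/
theorem tangent_apply_jet (p : Fin s → ℂ) (ψ : Tangent (LocalRing (affinePoint p)) n)
    (f : vanishing (affinePoint p)) :
    ψ (jet (affinePoint p) n f) = taylorFunctional p (coords p n ψ) f.1 := by
  rw [jet_eq_sum, map_sum, taylorFunctional_apply]
  refine Finset.sum_congr rfl fun α _ => ?_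
  rw [map_smul, smul_eq_mul, mul_comm]
  rfl

theorem coords_bijective (p : Fin s → ℂ) (n : ℕ) : Function.Bijective (coords p n) := by
  constructor
  · intro ψ ψ' h
    refine LinearMap.ext fun c => ?_
    obtain ⟨f, rfl⟩ := jet_surjective _ n c
    rw [tangent_apply_jet, h, ← tangent_apply_jet]
  · intro t
    obtain ⟨ψ, hψ⟩ := exists_tangent_apply_jet (affinePoint p) n
      (taylorFunctional p t ∘ₗ (vanishing (affinePoint p)).subtype) (by
        intro f hf
        rw [mem_ker_affinePoint_pow] at hf
        change taylorFunctional p t f.1 = 0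
        rw [taylorFunctional_apply]
        exact Finset.sum_eq_zero fun α _ => by rw [hf α.1 (Nat.lt_succ_iff.2 α.2.2), mul_zero])
    exact ⟨ψ, funext fun α => (hψ _).trans (taylorFunctional_shiftedMonomial p t α)⟩

theorem taylorFunctional_mul_shiftedMonomial (p : Fin s → ℂ) (t : ColIdx s n → ℂ)
    (F : MvPolynomial (Fin s) ℂ) (β : RowIdx s n) :
    taylorFunctional p t (F * shiftedMonomial p β.1) = (jacobianAt n F p).mulVec t β := by
  classical
  rw [taylorFunctional_apply, Matrix.mulVec, dotProduct]
  refine Finset.sum_congr rfl fun α _ => ?_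
  rw [mul_comm, map_mul, translate_shiftedMonomial, coeff_mul_monomial']
  congr 1
  simp only [jacobianAt, jacobian, Matrix.map_apply, Matrix.of_apply, map_mul, eval_C]
  split_ifs with h
  · have hfac : (multiFactorial α.1 : ℂ) =
        multiChoose α.1 β.1 * multiFactorial β.1 * multiFactorial (α.1 - β.1) := by
      simp only [multiFactorial, multiChoose, ← Nat.cast_mul, ← Finset.prod_mul_distrib]
      exact congrArg _ (Finset.prod_congr rfl fun i _ =>
        (Nat.choose_mul_factorial_mul_factorial (h i)).symm)
    have hne := multiFactorial_ne_zero α.1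
    rw [hfac, mul_ne_zero_iff, mul_ne_zero_iff] at hne
    obtain ⟨⟨h1, h2⟩, h3⟩ := hne
    rw [← eval_partialD_div_multiFactorial, hfac]
    field_simp
  · simp

theorem taylorFunctional_mul_eq_zero_iff (p : Fin s → ℂ) (t : ColIdx s n → ℂ)
    (F : MvPolynomial (Fin s) ℂ) (hp : eval p F = 0) :
    (∀ h, taylorFunctional p t (F * h) = 0) ↔ (jacobianAt n F p).mulVec t = 0 := by
  classical
  refine ⟨fun H => funext fun β => by rw [← taylorFunctional_mul_shiftedMonomial, H]; rfl,
    fun H h => ?_⟩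
  have key : ∀ β, taylorFunctional p t (F * shiftedMonomial p β) = 0 := by
    intro β
    by_cases hβ : β.degree < n
    · exact (taylorFunctional_mul_shiftedMonomial p t F ⟨β, hβ⟩).trans (congrFun H _)
    rw [taylorFunctional_apply]
    refine Finset.sum_eq_zero fun α _ => ?_
    rw [map_mul, translate_shiftedMonomial, coeff_mul_monomial']
    split_ifs with hle
    · -- `β ≤ α` and `|α| ≤ n ≤ |β|` leave only `α = β`, where the coefficient is `F(p)`.
      have hdeg : (α.1 - β).degree = 0 := by
        have := congrArg Finsupp.degree (tsub_add_cancel_of_le hle)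
        rw [map_add] at this
        have := α.2.2
        omega
      rw [(Finsupp.degree_eq_zero_iff _).1 hdeg, constantCoeff_translate, hp, zero_mul, mul_zero]
    · simp
  -- By linearity it suffices to test on the basis `(x - p)^β`, the preimage of `x^β` under
  -- `translate p`.
  have hmap : (taylorFunctional p t ∘ₗ LinearMap.mulLeft ℂ F) ∘ₗ
      (translate p).symm.toLinearMap = 0 := by
    refine MvPolynomial.linearMap_ext fun β => LinearMap.ext_ring ?_
    have := key β
    rwa [← (translate p).symm_apply_apply (shiftedMonomial p β), translate_shiftedMonomial] at this
  simpa using LinearMap.congr_fun hmap (translate p h)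

end Functionals

/-! ### The tangent space of a hypersurface -/

section Hypersurface

variable {s : ℕ} (F : MvPolynomial (Fin s) ℂ) (p : Fin s → ℂ) (hp : eval p F = 0) (n : ℕ)

theorem cotangentMap_jet (f : vanishing (affinePoint p)) :
    cotangentMap (restrictGerm F p hp) n (jet (affinePoint p) n f) =
      jet (hypersurfacePoint F p hp) n ⟨Ideal.Quotient.mk _ f.1, f.2⟩ := by
  refine congrArg (Submodule.Quotient.mk (p := _)) (Subtype.ext ?_)
  exact Localization.localRingHom_to_map _ _ _ (ker_affinePoint F p hp) f.1

theorem cotangentMap_restrictGerm_surjective :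
    Function.Surjective (cotangentMap (restrictGerm F p hp) n) := by
  intro c
  obtain ⟨⟨g, hg⟩, rfl⟩ := jet_surjective _ n c
  obtain ⟨f, rfl⟩ := Ideal.Quotient.mk_surjective g
  exact ⟨jet (affinePoint p) n ⟨f, hg⟩, cotangentMap_jet F p hp n _⟩

theorem mul_mem_vanishing (hp : eval p F = 0) (h : MvPolynomial (Fin s) ℂ) :
    F * h ∈ vanishing (affinePoint p) := by
  change F * h ∈ RingHom.ker (affinePoint p)
  rw [mem_ker_affinePoint, map_mul, hp, zero_mul]

/-- The kernel of the restriction of jets from `ℂ^s` to `V(F)` consists of the jets of multiples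
of `F`. -/
theorem cotangentMap_restrictGerm_eq_zero_iff (c : Cotangent (LocalRing (affinePoint p)) n) :
    cotangentMap (restrictGerm F p hp) n c = 0 ↔
      ∃ h, c = jet (affinePoint p) n ⟨F * h, mul_mem_vanishing F p hp h⟩ := by
  constructor
  · intro hc
    obtain ⟨f, rfl⟩ := jet_surjective _ n c
    rw [cotangentMap_jet, jet_eq_zero_iff] at hc
    have hker : RingHom.ker (hypersurfacePoint F p hp) =
        (RingHom.ker (affinePoint p)).map (Ideal.Quotient.mk (Ideal.span {F})) := by
      rw [ker_affinePoint F p hp]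
      exact (Ideal.map_comap_of_surjective _ Ideal.Quotient.mk_surjective _).symm
    rw [hker, ← Ideal.map_pow,
      Ideal.mem_map_iff_of_surjective _ Ideal.Quotient.mk_surjective] at hc
    obtain ⟨g, hg, hgf⟩ := hc
    rw [eq_comm, Ideal.Quotient.eq, Ideal.mem_span_singleton] at hgf
    obtain ⟨h, hh⟩ := hgf
    refine ⟨h, ?_⟩
    rw [← sub_eq_zero, ← map_sub, jet_eq_zero_iff]
    rw [sub_eq_iff_eq_add] at hh
    simpa [hh] using hg
  · rintro ⟨h, rfl⟩
    rw [cotangentMap_jet, jet_eq_zero_iff]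
    have : Ideal.Quotient.mk (Ideal.span {F}) (F * h) = 0 :=
      Ideal.Quotient.eq_zero_iff_mem.2 (Ideal.mem_span_singleton.2 (dvd_mul_right F h))
    simp only [this, zero_mem]

theorem mem_range_tangentInclusion_iff (ψ : Tangent (LocalRing (affinePoint p)) n) :
    ψ ∈ LinearMap.range (tangentInclusion F p hp n) ↔
      (jacobianAt n F p).mulVec (coords p n ψ) = 0 := by
  rw [← taylorFunctional_mul_eq_zero_iff p _ F hp, tangentInclusion, tangentMap,
    LinearMap.range_dualMap_eq_dualAnnihilator_ker, Submodule.mem_dualAnnihilator]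
  simp only [LinearMap.mem_ker, cotangentMap_restrictGerm_eq_zero_iff, forall_exists_index,
    forall_eq_apply_imp_iff, tangent_apply_jet]

end Hypersurface

end HigherTangent

end

theorem mainTheorem5 (s n : ℕ) (F : MvPolynomial (Fin s) ℂ) (p : Fin s → ℂ)
    (hp : MvPolynomial.eval p F = 0)
    (hns : IsRegularLocalRing
      (HigherTangent.LocalRing (HigherTangent.hypersurfacePoint F p hp))) :
    -- the identification of the dual of `𝔪 / 𝔪 ^ (n + 1)` for `ℂ^s` with `ℂ^(N-1)`,
    -- and its description by Taylor coefficients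
    Function.Bijective (HigherTangent.coords p n) ∧
    (∀ (ψ : HigherTangent.Tangent
          (HigherTangent.LocalRing (HigherTangent.affinePoint p)) n)
        (f : HigherTangent.vanishing (HigherTangent.affinePoint p)),
      ψ (HigherTangent.jet (HigherTangent.affinePoint p) n f) =
        ∑ α : HigherTangent.ColIdx s n, HigherTangent.coords p n ψ α *
          (MvPolynomial.eval p (HigherTangent.partialD α.1 f.1) /
            HigherTangent.multiFactorial α.1)) ∧
    -- the inclusion of the tangent space of the hypersurface
    Function.Injective (HigherTangent.tangentInclusion F p hp n) ∧
    -- the tangent space of the hypersurface, as a subspace of `ℂ^(N-1)`, is the kernel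
    LinearMap.range (HigherTangent.coords p n ∘ₗ HigherTangent.tangentInclusion F p hp n) =
      LinearMap.ker (Matrix.mulVecLin (HigherTangent.jacobianAt n F p)) := by
  refine ⟨HigherTangent.coords_bijective p n, fun ψ f => ?_,
    LinearMap.dualMap_injective_of_surjective
      (HigherTangent.cotangentMap_restrictGerm_surjective F p hp n), ?_⟩
  · simp_rw [HigherTangent.eval_partialD_div_multiFactorial]
    rw [HigherTangent.tangent_apply_jet, HigherTangent.taylorFunctional_apply]
  · ext t
    obtain ⟨ψ, rfl⟩ := (HigherTangent.coords_bijective p n).2 t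
    rw [LinearMap.range_comp, ← SetLike.mem_coe, Submodule.map_coe,
      (HigherTangent.coords_bijective p n).1.mem_set_image, SetLike.mem_coe,
      HigherTangent.mem_range_tangentInclusion_iff,
      LinearMap.mem_ker, Matrix.mulVecLin_apply]
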